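/- Let $I_0=[0,1]$ and fix $0<\tau<1$. A set $J\subseteq I\subseteq\mathbb R$ is an $r$-similarity of $I$ if $J=S(I)$ for a similarity $S$ of $\mathbb R$ with contraction factor $r>0$; a family $J_1,\dots,J_t$ of $r$-similarities of $I$ is $\tau$-separated if $d(J_i,J_j)\ge\tau r\,\mathrm{diam}(I)$ for $i\ne j$. For each integer $t\ge2$ let $r_t\in(0,1/2]$ be such that for every $0<r\le r_t$ the interval $I_0$ contains $t$ $\tau$-separated $r$-similarities of itself. Let $\mathcal S_t=\{x\in\mathbb R^t: x_i>0,\ \sum_i x_i=1\}$, let $\Omega_0$ be the disjoint union of the sets $(0,r_t]\times\mathcal S_t$, $t\ge2$, let $\pi$ be a Borel probability measure on $\Omega_0$, and let $\mathbb P$ be the product measure $\pi^{\mathbb N}$ on $\Omega=\Omega_0^{\mathbb N}$. Thus $\omega\in\Omega$ is an i.i.d. sequence of triples $(T_n,r_n,p_n)$, $n\ge1$, with $p_n=(p_n^{(1)},\dots,p_n^{(T_n)})\in\mathcal S_{T_n}$ and $r_n\le r_{T_n}$ (the bound attached to $t=T_n$); in particular, for every $n$ the pair $\{p_{n+1},r_{n+1}\}$,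 and so $\{m_{n+1},r_{n+1}\}$ below, is independent of the earlier ones. Put $m_n=\min_j p_n^{(j)}$ and $M_n=\max_j p_n^{(j)}$, and assume that there is $A>0$ with $\mathbb E(r_1^{-\lambda})<\infty$ for all $|\lambda|\le A$. For every $\omega$ choose Moran sets as follows: $I_0$ is the only Moran set of step $0$, and each Moran set $I$ of step $n$ is given $T_{n+1}(\omega)$ children $I^{(1)},\dots,I^{(T_{n+1})}$, which are $\tau$-separated $r_{n+1}(\omega)$-similarities of $I$; the children are the Moran sets of step $n+1$. Let $\mu=\mu_\omega$ be the Borel probability measure on $\mathbb R$ determined by $\mu(I_0)=1$ and $\mu(I^{(j)})=\mu(I)\,p_{n+1}^{(j)}$ for each Moran set $I$ of step $n$ and each $j\le T_{n+1}$; it is supported on $E(\omega)=\bigcap_{n\ge1}\bigcup\{I: I\text{ a Moran set of step }n\}$. A dimension function is a map $\Phi:(0,1)\to[0,\infty)$ such that $x^{1+\Phi(x)}$ decreases to $0$ as $x$ decreases to $0$. It is small if there are $\delta>0$ and a function $A$ with $A(x)\to\infty$ as $x\to0^+$ and $\log|\log x|/|\log x|\ge A(x)\Phi(x)$ for $0<x<\delta$.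 The upper $\Phi$-dimension $\overline{\dim}_\Phi\mu$ is the infimum in $[-\infty,\infty]$ of all $d\in\mathbb R$ for which there are $C_1\in(0,1)$ and $C_2>0$ such that $$\frac{\mu(B(x,R))}{\mu(B(x,r))}\le C_2\Big(\frac Rr\Big)^d\quad\text{for all }0<r<R^{1+\Phi(R)}\le R\le C_1\text{ and all }x\in\mathrm{supp}\,\mu,$$ and the lower $\Phi$-dimension $\underline{\dim}_\Phi\mu$ is the supremum of all $d\in\mathbb R$ for which the same holds with $\ge$ in place of $\le$ in the displayed inequality. Here $B(x,R)$ is the open ball. Let $\Phi$ be a small dimension function. (a) Suppose that almost surely, for every $n\ge1$, the gaps adjacent to each Moran interval of step $n$ whose measure is $m_n$ times that of its parent have length at least $\tau r_1\cdots r_{n-1}$ (that is, its distance to every other Moran interval of step $n$ is at least $\tau r_1\cdots r_{n-1}$). If there are constants $\theta,c>0$ such that $\mathbb P(m_1\le z)\ge cz^\theta$ for all sufficiently small $z>0$, then $\overline{\dim}_\Phi\mu=\infty$ almost surely. (b) Suppose that the same gap condition holds almost surely with $M_n$ in place of $m_n$. If there are constants $\theta,c>0$ such that $\mathbb P(r_1\le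 z)\ge cz^\theta$ for all sufficiently small $z>0$, then $\underline{\dim}_\Phi\mu=0$ almost surely. -/

import Mathlib

open MeasureTheory Filter Topology Set

noncomputable section

namespace RandomMoran

/-! ### Dimension functions and the `Φ`-dimensions of a measure -/

/-- A dimension function is a map `Φ : (0,1) → [0,∞)` such that `x ^ (1 + Φ x)` decreases to `0`
as `x` decreases to `0`. Only the values of `Φ` on `(0,1)` are ever used. -/
structure IsDimensionFunction (Φ : ℝ → ℝ) : Prop where
  nonneg : ∀ x ∈ Ioo (0 : ℝ) 1, 0 ≤ Φ x
  mono : MonotoneOn (fun x : ℝ => x ^ (1 + Φ x)) (Ioo 0 1)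
  tendsto : Tendsto (fun x : ℝ => x ^ (1 + Φ x)) (𝓝[>] 0) (𝓝 0)

/-- `f ≫ g` near `0`: `f x ≥ A x * g x` for all small `x > 0`, where `A x → ∞` as `x → 0⁺`. -/
def MuchGreater (f g : ℝ → ℝ) : Prop :=
  ∃ (A : ℝ → ℝ) (δ : ℝ), 0 < δ ∧ (∀ x, 0 < x → x < δ → A x * g x ≤ f x) ∧
    Tendsto A (𝓝[>] 0) atTop

/-- `Φ` is small: `Φ x ≪ log |log x| / |log x|`. -/
def IsSmall (Φ : ℝ → ℝ) : Prop :=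
  MuchGreater (fun x => Real.log |Real.log x| / |Real.log x|) Φ

/-- The exponents `d` admitted in the definition of the upper `Φ`-dimension. Since `Φ` lives on
`(0,1)`, the constant `C₁` is taken in `(0,1)`; shrinking `C₁` only weakens the condition. -/
def upperExponents (Φ : ℝ → ℝ) (μ : Measure ℝ) : Set ℝ :=
  {d | ∃ C₁ C₂ : ℝ, 0 < C₁ ∧ C₁ < 1 ∧ 0 < C₂ ∧
    ∀ r R : ℝ, 0 < r → r < R ^ (1 + Φ R) → R ^ (1 + Φ R) ≤ R → 0 < R → R ≤ C₁ →
      ∀ x ∈ μ.support,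
        μ.real (Metric.ball x R) / μ.real (Metric.ball x r) ≤ C₂ * (R / r) ^ d}

/-- The exponents `d` admitted in the definition of the lower `Φ`-dimension. -/
def lowerExponents (Φ : ℝ → ℝ) (μ : Measure ℝ) : Set ℝ :=
  {d | ∃ C₁ C₂ : ℝ, 0 < C₁ ∧ C₁ < 1 ∧ 0 < C₂ ∧
    ∀ r R : ℝ, 0 < r → r < R ^ (1 + Φ R) → R ^ (1 + Φ R) ≤ R → 0 < R → R ≤ C₁ →
      ∀ x ∈ μ.support,
        C₂ * (R / r) ^ d ≤ μ.real (Metric.ball x R) / μ.real (Metric.ball x r)}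

/-- The upper `Φ`-dimension of `μ`, an extended real (`inf ∅ = ∞`). -/
def upperDim (Φ : ℝ → ℝ) (μ : Measure ℝ) : EReal :=
  sInf ((fun d : ℝ => (d : EReal)) '' upperExponents Φ μ)

/-- The lower `Φ`-dimension of `μ`, an extended real. -/
def lowerDim (Φ : ℝ → ℝ) (μ : Measure ℝ) : EReal :=
  sSup ((fun d : ℝ => (d : EReal)) '' lowerExponents Φ μ)

/-! ### Separated similarities -/

/-- `J ⊆ I` is the image of `I` under a similarity of the line with contraction factor `r`. -/
def IsSimilarCopy (r : ℝ) (I J : Set ℝ) : Prop :=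
  J ⊆ I ∧ ∃ S : ℝ → ℝ, (∀ x y, dist (S x) (S y) = r * dist x y) ∧ J = S '' I

/-- Any two points of `J` and `J'` are at distance at least `δ`, i.e. `d(J, J') ≥ δ`. -/
def IsApart (δ : ℝ) (J J' : Set ℝ) : Prop :=
  ∀ x ∈ J, ∀ y ∈ J', δ ≤ dist x y

/-- The `(t, r, τ)`-separation property of `I`. -/
def HasSeparation (I : Set ℝ) (t : ℕ) (r τ : ℝ) : Prop :=
  ∃ J : Fin t → Set ℝ, (∀ i, IsSimilarCopy r I (J i)) ∧
    ∀ i j, i ≠ j → IsApart (τ * r * Metric.diam I) (J i) (J j)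

/-! ### The probability space -/

/-- The open probability simplex in `ℝ^t`. -/
abbrev OpenSimplex (t : ℕ) : Type :=
  {p : Fin t → ℝ // (∀ i, 0 < p i) ∧ ∑ i, p i = 1}

/-- The disjoint union over `t ≥ 2` of `(0, r_t] × S_t`, with `r_t = ρ t`; its (Borel)
`σ`-algebra is the one of a disjoint union. -/
abbrev Step (ρ : ℕ → ℝ) : Type :=
  Σ t : {t : ℕ // 2 ≤ t}, Ioc (0 : ℝ) (ρ t) × OpenSimplex t

variable {ρ : ℕ → ℝ}

/-- The number of children. -/
def Step.T (s : Step ρ) : ℕ := s.1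

/-- The ratio. -/
def Step.r (s : Step ρ) : ℝ := s.2.1

/-- The probability vector. -/
def Step.p (s : Step ρ) : Fin s.T → ℝ := s.2.2.1

/-- The minimal probability `m`. -/
def Step.m (s : Step ρ) : ℝ := ⨅ j, s.p j

/-- The maximal probability `M`. -/
def Step.M (s : Step ρ) : ℝ := ⨆ j, s.p j

lemma Step.two_le_T (s : Step ρ) : 2 ≤ s.T := s.1.2

lemma Step.r_pos (s : Step ρ) : 0 < s.r := s.2.1.2.1

lemma Step.p_pos (s : Step ρ) (j : Fin s.T) : 0 < s.p j := s.2.2.2.1 j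

lemma Step.p_sum (s : Step ρ) : ∑ j, s.p j = 1 := s.2.2.2.2

/-- The infinite product; the entry `ω n` is the triple `(T_{n+1}, r_{n+1}, p_{n+1})`. -/
abbrev Samples (ρ : ℕ → ℝ) : Type := ℕ → Step ρ

/-- The product measure induced by `π`: the entries of `ω` are iid with law `π`. -/
def law (π : Measure (Step ρ)) [IsProbabilityMeasure π] : Measure (Samples ρ) :=
  Measure.infinitePi (fun _ : ℕ => π)

/-! ### Random Moran sets -/

/-- The labels of the Moran sets of step `n`: a child `(w, j)` is a parent `w` together with a
number `j < T_{n+1}`. -/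
def Word (ω : Samples ρ) : ℕ → Type
  | 0 => Unit
  | n + 1 => Word ω n × Fin (ω n).T

/-- The label of the `j`-th child of `w`. -/
def Word.child {ω : Samples ρ} {n : ℕ} (w : Word ω n) (j : Fin (ω n).T) : Word ω (n + 1) :=
  (w, j)

/-- A choice of the Moran sets for the sample `ω`, starting from `I₀ = [0,1]`: the children of
each Moran set of step `n` are `T_{n+1}` many `r_{n+1}`-similarities of it, `τ`-separated. -/
structure MoranSets (τ : ℝ) (ω : Samples ρ) where
  I : (n : ℕ) → Word ω n → Set ℝ
  I_zero : ∀ w : Word ω 0, I 0 w = Icc 0 1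
  similar : ∀ (n : ℕ) (w : Word ω n) (j : Fin (ω n).T),
    IsSimilarCopy (ω n).r (I n w) (I (n + 1) (w.child j))
  separated : ∀ (n : ℕ) (w : Word ω n) (i j : Fin (ω n).T), i ≠ j →
    IsApart (τ * (ω n).r * Metric.diam (I n w)) (I (n + 1) (w.child i)) (I (n + 1) (w.child j))

/-- The random Moran set `E(ω) = ⋂_{n ≥ 1} M_n(ω)`. -/
def MoranSets.E {τ : ℝ} {ω : Samples ρ} (C : MoranSets τ ω) : Set ℝ :=
  ⋂ n : ℕ, ⋃ w : Word ω (n + 1), C.I (n + 1) w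

/-- The stronger separation condition for the children of minimal probability: each Moran set of
step `n + 1` whose measure is `m_{n+1}` times the one of its parent has distance at least
`τ r_1 ⋯ r_n` to all other Moran sets of step `n + 1`, so that the gaps adjacent to it have at
least that length. -/
def MoranSets.StrongMin {τ : ℝ} {ω : Samples ρ} (C : MoranSets τ ω) : Prop :=
  ∀ (n : ℕ) (w : Word ω n) (j : Fin (ω n).T), (ω n).p j = (ω n).m →
    ∀ v : Word ω (n + 1), v ≠ w.child j →
      IsApart (τ * ∏ k ∈ Finset.range n, (ω k).r) (C.I (n + 1) (w.child j)) (C.I (n + 1) v)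

/-- The stronger separation condition for the children of maximal probability. -/
def MoranSets.StrongMax {τ : ℝ} {ω : Samples ρ} (C : MoranSets τ ω) : Prop :=
  ∀ (n : ℕ) (w : Word ω n) (j : Fin (ω n).T), (ω n).p j = (ω n).M →
    ∀ v : Word ω (n + 1), v ≠ w.child j →
      IsApart (τ * ∏ k ∈ Finset.range n, (ω k).r) (C.I (n + 1) (w.child j)) (C.I (n + 1) v)

/-! ### Random Moran measures

The measure is the law of the point of `E(ω)` whose successive children are chosen independently
with the probabilities `p_1, p_2, …`. The theorem `moranMeasure_child` below shows that it obeys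
the rule `μ(I^{(j)}) = μ(I) p_{n+1}^{(j)}`, `μ(I₀) = 1`, which determines it. -/

/-- The measure on `{1, …, T}` with weights `p`. -/
def Step.weights (s : Step ρ) : Measure (Fin s.T) :=
  ∑ j, ENNReal.ofReal (s.p j) • Measure.dirac j

lemma Step.weights_singleton (s : Step ρ) (j : Fin s.T) :
    s.weights {j} = ENNReal.ofReal (s.p j) := by
  classical
  simp [Step.weights, Measure.finsetSum_apply, Set.indicator_apply]

instance (s : Step ρ) : IsProbabilityMeasure s.weights := by
  refine ⟨?_⟩
  simp only [Step.weights, Measure.finsetSum_apply, Measure.smul_apply, measure_univ, smul_eq_mul,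
    mul_one]
  rw [← ENNReal.ofReal_sum_of_nonneg (fun j _ => (s.p_pos j).le), s.p_sum, ENNReal.ofReal_one]

/-- Infinite paths down the tree of Moran sets. -/
abbrev Path (ω : Samples ρ) : Type := (n : ℕ) → Fin (ω n).T

/-- The label of the Moran set of step `n` on the path `x`. -/
def Path.word {ω : Samples ρ} (x : Path ω) : (n : ℕ) → Word ω n
  | 0 => ()
  | n + 1 => (Path.word x n).child (x n)

/-- The point on the path `x`: the limit of the left endpoints of the Moran sets on `x`. -/
def MoranSets.point {τ : ℝ} {ω : Samples ρ} (C : MoranSets τ ω) (x : Path ω) : ℝ :=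
  ⨆ n, sInf (C.I n (x.word n))

/-- The Moran measure `μ_ω`. -/
def moranMeasure {τ : ℝ} {ω : Samples ρ} (C : MoranSets τ ω) : Measure ℝ :=
  (Measure.infinitePi (fun n : ℕ => (ω n).weights)).map C.point

namespace MoranSets

variable {τ : ℝ} {ω : Samples ρ} (C : MoranSets τ ω)

lemma isCompact (n : ℕ) (w : Word ω n) : IsCompact (C.I n w) := by
  induction n with
  | zero => rw [C.I_zero]; exact isCompact_Icc
  | succ n ih =>
    obtain ⟨-, S, hS, h⟩ := C.similar n w.1 w.2
    have h' : C.I (n + 1) w = S '' C.I n w.1 := h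
    rw [h']
    refine (ih w.1).image ?_
    have : LipschitzWith (ω n).r.toNNReal S :=
      LipschitzWith.of_dist_le_mul fun x y => by
        rw [hS, Real.coe_toNNReal _ (ω n).r_pos.le]
    exact this.continuous

lemma nonempty (n : ℕ) (w : Word ω n) : (C.I n w).Nonempty := by
  induction n with
  | zero => rw [C.I_zero]; exact ⟨0, by simp⟩
  | succ n ih =>
    obtain ⟨-, S, hS, h⟩ := C.similar n w.1 w.2
    have h' : C.I (n + 1) w = S '' C.I n w.1 := h
    rw [h']
    exact (ih w.1).image _

lemma diam_pos (n : ℕ) (w : Word ω n) : 0 < Metric.diam (C.I n w) := by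
  suffices h : ∃ x ∈ C.I n w, ∃ y ∈ C.I n w, 0 < dist x y by
    obtain ⟨x, hx, y, hy, h⟩ := h
    exact h.trans_le (Metric.dist_le_diam_of_mem (C.isCompact n w).isBounded hx hy)
  induction n with
  | zero => rw [C.I_zero]; exact ⟨0, by simp, 1, by simp, by simp⟩
  | succ n ih =>
    obtain ⟨-, S, hS, h⟩ := C.similar n w.1 w.2
    have h' : C.I (n + 1) w = S '' C.I n w.1 := h
    obtain ⟨x, hx, y, hy, hxy⟩ := ih w.1
    rw [h']
    refine ⟨S x, mem_image_of_mem _ hx, S y, mem_image_of_mem _ hy, ?_⟩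
    rw [hS]
    exact mul_pos (ω n).r_pos hxy

lemma disjoint (hτ : 0 < τ) (n : ℕ) (v w : Word ω n) (x : ℝ) (hv : x ∈ C.I n v)
    (hw : x ∈ C.I n w) : v = w := by
  induction n with
  | zero => rfl
  | succ n ih =>
    obtain ⟨v, i⟩ := v
    obtain ⟨w, j⟩ := w
    have h1 := ih v w ((C.similar n v i).1 hv) ((C.similar n w j).1 hw)
    subst h1
    by_contra hne
    have hij : i ≠ j := fun h => hne (by rw [h])
    have := C.separated n v i j hij x hv x hw
    rw [dist_self] at this
    exact absurd this (not_le.2 (mul_pos (mul_pos hτ (ω n).r_pos) (C.diam_pos n v)))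

lemma antitone_path (x : Path ω) : Antitone fun n => C.I n (x.word n) :=
  antitone_nat_of_succ_le fun n => (C.similar n (x.word n) (x n)).1

/-- The point on the path `x` lies in all the Moran sets on `x`. -/
lemma point_mem (x : Path ω) (n : ℕ) : C.point x ∈ C.I n (x.word n) := by
  have hmem : ∀ k, sInf (C.I k (x.word k)) ∈ C.I k (x.word k) := fun k =>
    (C.isCompact k _).sInf_mem (C.nonempty k _)
  have hmono : Monotone fun k => sInf (C.I k (x.word k)) := fun a b hab =>
    csInf_le_csInf (C.isCompact a _).bddBelow (C.nonempty b _) (C.antitone_path x hab)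
  have hbdd : BddAbove (range fun k => sInf (C.I k (x.word k))) := by
    refine ⟨1, ?_⟩
    rintro _ ⟨k, rfl⟩
    have := C.antitone_path x (Nat.zero_le k) (hmem k)
    simp only [C.I_zero] at this
    exact this.2
  refine (C.isCompact n _).isClosed.mem_of_tendsto (tendsto_atTop_ciSup hmono hbdd) ?_
  filter_upwards [eventually_ge_atTop n] with k hk
  exact C.antitone_path x hk (hmem k)

lemma point_mem_iff (hτ : 0 < τ) (x : Path ω) (n : ℕ) (w : Word ω n) :
    C.point x ∈ C.I n w ↔ x.word n = w :=
  ⟨fun h => C.disjoint hτ n _ _ _ (C.point_mem x n) h, fun h => h ▸ C.point_mem x n⟩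

end MoranSets

/-- The paths through `w` form a box. -/
lemma Path.exists_box {ω : Samples ρ} (n : ℕ) (w : Word ω n) :
    ∃ s : (k : ℕ) → Set (Fin (ω k).T),
      {x : Path ω | x.word n = w} = Set.pi (Finset.range n : Set ℕ) s ∧
      ∀ j, {x : Path ω | x.word (n + 1) = w.child j} =
        Set.pi (Finset.range (n + 1) : Set ℕ) (Function.update s n {j}) := by
  have key : ∀ (s : (k : ℕ) → Set (Fin (ω k).T)) (n : ℕ) (w : Word ω n),
      {x : Path ω | x.word n = w} = Set.pi (Finset.range n : Set ℕ) s →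
      ∀ j, {x : Path ω | x.word (n + 1) = w.child j} =
        Set.pi (Finset.range (n + 1) : Set ℕ) (Function.update s n {j}) := by
    intro s n w hs j
    ext x
    have h1 : x.word n = w ↔ ∀ k < n, x k ∈ s k := by
      have := Set.ext_iff.1 hs x
      simpa [Set.mem_pi] using this
    have h2 : x.word (n + 1) = w.child j ↔ x.word n = w ∧ x n = j := Prod.ext_iff
    have h3 : ∀ k < n, Function.update s n {j} k = s k := fun k hk =>
      Function.update_of_ne hk.ne _ _
    simp only [mem_ofPred_eq, h2, h1, Set.mem_pi, Finset.coe_range, mem_Iio, Nat.lt_succ_iff]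
    constructor
    · rintro ⟨ha, hb⟩ k hk
      rcases hk.lt_or_eq with h | rfl
      · rw [h3 k h]; exact ha k h
      · simpa using hb
    · intro h
      refine ⟨fun k hk => ?_, by simpa using h n le_rfl⟩
      have := h k hk.le
      rwa [h3 k hk] at this
  suffices h : ∃ s : (k : ℕ) → Set (Fin (ω k).T),
      {x : Path ω | x.word n = w} = Set.pi (Finset.range n : Set ℕ) s by
    obtain ⟨s, hs⟩ := h
    exact ⟨s, hs, key s n w hs⟩
  induction n with
  | zero => exact ⟨fun _ => univ, by
      ext x
      have h : x.word 0 = w := rfl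
      simp [h]⟩
  | succ n ih =>
    obtain ⟨s, hs⟩ := ih w.1
    exact ⟨_, key s n w.1 hs w.2⟩

lemma Path.measurableSet_word {ω : Samples ρ} (n : ℕ) (w : Word ω n) :
    MeasurableSet {x : Path ω | x.word n = w} := by
  obtain ⟨s, hs, -⟩ := Path.exists_box n w
  rw [hs]
  exact MeasurableSet.pi (Finset.countable_toSet _) fun _ _ => MeasurableSet.of_discrete

lemma Word.finite (ω : Samples ρ) (n : ℕ) : Finite (Word ω n) := by
  induction n with
  | zero => exact inferInstanceAs (Finite Unit)
  | succ n ih => exact inferInstanceAs (Finite (Word ω n × Fin (ω n).T))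

lemma MoranSets.measurable_point {τ : ℝ} {ω : Samples ρ} (C : MoranSets τ ω) :
    Measurable C.point := by
  refine Measurable.iSup fun n => ?_
  have := Word.finite ω n
  let _ : MeasurableSpace (Word ω n) := ⊤
  have h : Measurable fun x : Path ω => x.word n :=
    measurable_to_countable' fun w => Path.measurableSet_word n w
  exact (measurable_from_top (f := fun w : Word ω n => sInf (C.I n w))).comp h

instance {τ : ℝ} {ω : Samples ρ} (C : MoranSets τ ω) : IsProbabilityMeasure (moranMeasure C) :=
  Measure.isProbabilityMeasure_map C.measurable_point.aemeasurable

lemma moranMeasure_apply {τ : ℝ} {ω : Samples ρ} (C : MoranSets τ ω) (hτ : 0 < τ) (n : ℕ)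
    (w : Word ω n) :
    moranMeasure C (C.I n w) =
      Measure.infinitePi (fun n : ℕ => (ω n).weights) {x : Path ω | x.word n = w} := by
  rw [moranMeasure, Measure.map_apply C.measurable_point (C.isCompact n w).measurableSet]
  congr 1
  ext x
  exact C.point_mem_iff hτ x n w

/-- The whole mass sits on `I₀`. -/
theorem moranMeasure_root {τ : ℝ} {ω : Samples ρ} (C : MoranSets τ ω) (hτ : 0 < τ)
    (w : Word ω 0) : moranMeasure C (C.I 0 w) = 1 := by
  rw [moranMeasure_apply C hτ]
  have : {x : Path ω | x.word 0 = w} = univ := 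
    eq_univ_of_forall fun _ => rfl
  rw [this, measure_univ]

/-- The defining rule `μ(I^{(j)}) = μ(I) p_{n+1}^{(j)}`. -/
theorem moranMeasure_child {τ : ℝ} {ω : Samples ρ} (C : MoranSets τ ω) (hτ : 0 < τ) (n : ℕ)
    (w : Word ω n) (j : Fin (ω n).T) :
    moranMeasure C (C.I (n + 1) (w.child j)) =
      moranMeasure C (C.I n w) * ENNReal.ofReal ((ω n).p j) := by
  obtain ⟨s, h1, h2⟩ := Path.exists_box n w
  rw [moranMeasure_apply C hτ, moranMeasure_apply C hτ, h1, h2 j,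
    Measure.infinitePi_pi _ fun _ _ => MeasurableSet.of_discrete,
    Measure.infinitePi_pi _ fun _ _ => MeasurableSet.of_discrete, Finset.prod_range_succ]
  congr 1
  · refine Finset.prod_congr rfl fun k hk => ?_
    rw [Function.update_of_ne (Finset.mem_range.1 hk).ne]
  · rw [Function.update_self, Step.weights_singleton]

end RandomMoran

end

namespace RandomMoran

/-! ### Almost sure asymptotics of the random steps -/

section Probability

variable {ρ : ℕ → ℝ}

/-! Polynomial fluctuations of one step beat the width of the scale window allowed by a small `Φ`.
Let `L` be the length of the Moran sets of step `n`. By the law of large numbers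
(`ae_exists_sum_neg_log_le`) `-log L` grows at most linearly in `n`. For `R` comparable to `L`,
smallness then gives `R ^ (-Φ R) ≤ (n + 1) ^ ε` eventually, for every `ε > 0`
(`IsSmall.eventually_seq_rpow_neg_le`). On the other hand, the tail hypothesis at `z = (n + 1) ^
(-(1 / θ))` gives probabilities at least `c / (n + 1)`, so by independence and Borel–Cantelli `m`
(resp. the ratio) is below this `z` infinitely often (`ae_frequently_le_rpow`).

(a) Center balls at a support point of a minimal child. One of radius `2L` contains the parent, one
of radius just below `R ^ (1 + Φ R)` sees only that child. The measures differ by a factor `(n + 1)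
^ (1 / θ)`, the radii only by `(n + 1) ^ ε` up to a constant, so no exponent is admitted.

(b) If the ratio `q` is tiny, the balls of radii `τL/2` and `2Lq` around a point of a maximal child
carry exactly the mass of that child. The radii differ by an unbounded factor, and smallness makes
this pair admissible; hence no positive exponent is admitted. The exponent `0` always is. -/

lemma Step.measurable_of_mk {f : Step ρ → ℝ} (h : ∀ t, Measurable fun x => f ⟨t, x⟩) :
    Measurable f :=
  fun _ hs => MeasurableSpace.measurableSet_iInf.2 fun t => h t hs

lemma Step.measurable_r : Measurable (Step.r : Step ρ → ℝ) :=
  Step.measurable_of_mk fun _ => measurable_subtype_coe.comp measurable_fst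

lemma Step.measurable_m : Measurable (Step.m : Step ρ → ℝ) :=
  Step.measurable_of_mk fun _ => Measurable.iInf fun j =>
    (measurable_pi_apply j).comp (measurable_subtype_coe.comp measurable_snd)

variable (π : Measure (Step ρ)) [IsProbabilityMeasure π]

lemma law_preimage_eval {B : Set (Step ρ)} (hB : MeasurableSet B) (n : ℕ) :
    law π {ω | ω n ∈ B} = π B :=
  (measurePreserving_eval_infinitePi (fun _ : ℕ => π) n).measure_preimage hB.nullMeasurableSet

/-- The second Borel–Cantelli lemma for the independent steps. -/
lemma ae_frequently_mem {B : ℕ → Set (Step ρ)} (hB : ∀ n, MeasurableSet (B n))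
    (hsum : ∑' n, π (B n) = ⊤) : ∀ᵐ ω ∂(law π), ∃ᶠ n in atTop, ω n ∈ B n := by
  have : IsProbabilityMeasure (law π) := by unfold law; infer_instance
  have hm : ∀ n, MeasurableSet {ω : Samples ρ | ω n ∈ B n} := fun n => measurable_pi_apply n (hB n)
  have hind : ProbabilityTheory.iIndepSet (fun n => {ω : Samples ρ | ω n ∈ B n}) (law π) := by
    rw [ProbabilityTheory.iIndepSet_iff_meas_biInter hm]
    intro s
    -- Finitely many of the events meet in a box, on which the product measure factorises.
    have h : (⋂ i ∈ s, {ω : Samples ρ | ω i ∈ B i}) = Set.pi (s : Set ℕ) B := by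
      ext ω; simp [Set.mem_pi]
    rw [h, law, Measure.infinitePi_pi _ fun i _ => hB i]
    exact Finset.prod_congr rfl fun i _ => (law_preimage_eval π (hB i) i).symm
  have h1 := ProbabilityTheory.measure_limsup_eq_one hm hind (by
    simpa only [law_preimage_eval π (hB _)] using hsum)
  have h2 : MeasurableSet (limsup (fun n => {ω : Samples ρ | ω n ∈ B n}) atTop) :=
    MeasurableSet.measurableSet_limsup hm
  filter_upwards [(prob_compl_eq_zero_iff h2).2 h1] with ω hω
  simpa [mem_limsup_iff_frequently_mem] using hω

/-- A quantity with a polynomial lower tail is infinitely often polynomially small. -/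
lemma ae_frequently_le_rpow {f : Step ρ → ℝ} (hf : Measurable f) {θ c : ℝ} (hθ : 0 < θ)
    (hc : 0 < c) (htail : ∀ᶠ z : ℝ in 𝓝[>] 0, c * z ^ θ ≤ (law π).real {ω | f (ω 0) ≤ z}) :
    ∀ᵐ ω ∂(law π), ∃ᶠ n : ℕ in atTop, f (ω n) ≤ ((n : ℝ) + 1) ^ (-(1 / θ)) := by
  have hB : ∀ z : ℝ, MeasurableSet {s : Step ρ | f s ≤ z} := fun z => hf measurableSet_Iic
  refine ae_frequently_mem π (B := fun n : ℕ => {s | f s ≤ ((n : ℝ) + 1) ^ (-(1 / θ))})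
    (fun n => hB _) ?_
  have hlim : Tendsto (fun n : ℕ => ((n : ℝ) + 1) ^ (-(1 / θ))) atTop (𝓝[>] 0) := by
    refine tendsto_nhdsWithin_iff.2 ⟨(tendsto_rpow_neg_atTop (by positivity)).comp
      (tendsto_natCast_atTop_atTop.atTop_add tendsto_const_nhds), Eventually.of_forall fun n => ?_⟩
    exact Real.rpow_pos_of_pos (by positivity) _
  obtain ⟨N, hN⟩ := eventually_atTop.1 (hlim.eventually htail)
  -- A finite sum would dominate `c` times a shifted harmonic series.
  by_contra hne
  have hs : Summable fun n : ℕ => π.real {s | f s ≤ ((n : ℝ) + 1) ^ (-(1 / θ))} :=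
    ENNReal.summable_toReal hne
  have hs' : Summable fun n : ℕ => c * (1 / ((n + N : ℕ) + 1 : ℝ)) := by
    refine Summable.of_nonneg_of_le (fun n => by positivity) (fun n => ?_)
      ((summable_nat_add_iff N).2 hs)
    have h := hN (n + N) (Nat.le_add_left _ _)
    have h0 : (law π).real {ω | f (ω 0) ≤ (((n + N : ℕ) : ℝ) + 1) ^ (-(1 / θ))} =
        π.real {s | f s ≤ (((n + N : ℕ) : ℝ) + 1) ^ (-(1 / θ))} :=
      congrArg ENNReal.toReal (law_preimage_eval π (hB _) 0)
    rw [h0, ← Real.rpow_mul (by positivity)] at h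
    have h3 : -(1 / θ) * θ = -1 := by field_simp
    rwa [h3, Real.rpow_neg_one, ← one_div] at h
  have h4 := (summable_mul_left_iff hc.ne').1 hs'
  have h5 := (summable_nat_add_iff (f := fun n : ℕ => 1 / ((n : ℝ) + 1)) N).1 h4
  exact Real.not_summable_one_div_natCast
    ((summable_nat_add_iff (f := fun n : ℕ => 1 / (n : ℝ)) 1).1 (by simpa using h5))

/-- The law of large numbers bounds the logarithms of the lengths linearly. -/
lemma ae_exists_sum_neg_log_le (hr : ∀ s : Step ρ, s.r ≤ 1) {A : ℝ} (hA : 0 < A)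
    (hint : Integrable (fun ω : Samples ρ => Real.exp (A * -Real.log (ω 0).r)) (law π)) :
    ∀ᵐ ω ∂(law π), ∃ K : ℝ, ∀ᶠ n : ℕ in atTop,
      ∑ k ∈ Finset.range n, -Real.log (ω k).r ≤ K * (n + 1) := by
  have hX : Measurable fun s : Step ρ => -Real.log s.r :=
    (Real.measurable_log.comp Step.measurable_r).neg
  have hXn : ∀ n, Measurable fun ω : Samples ρ => -Real.log (ω n).r :=
    fun n => hX.comp (measurable_pi_apply n)
  have h0 : Integrable (fun ω : Samples ρ => -Real.log (ω 0).r) (law π) := by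
    -- For `X = -log r ≥ 0`, the bound `A X + 1 ≤ exp (A X)` makes `exp (A X) / A` an integrable
    -- majorant.
    refine (hint.div_const A).mono' (hXn 0).aestronglyMeasurable (Eventually.of_forall fun ω => ?_)
    have hl : Real.log (ω 0).r ≤ 0 := Real.log_nonpos (ω 0).r_pos.le (hr _)
    rw [Real.norm_of_nonneg (by linarith), le_div_iff₀ hA, mul_comm]
    linarith [Real.add_one_le_exp (A * -Real.log (ω 0).r)]
  have hind : ProbabilityTheory.iIndepFun (fun (n : ℕ) (ω : Samples ρ) => -Real.log (ω n).r)
      (law π) := ProbabilityTheory.iIndepFun_infinitePi fun _ => hX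
  have hid : ∀ n, ProbabilityTheory.IdentDistrib (fun ω : Samples ρ => -Real.log (ω n).r)
      (fun ω : Samples ρ => -Real.log (ω 0).r) (law π) (law π) := fun n => by
    refine ⟨(hXn n).aemeasurable, (hXn 0).aemeasurable, ?_⟩
    ext s hs
    rw [Measure.map_apply (hXn n) hs, Measure.map_apply (hXn 0) hs]
    exact (law_preimage_eval π (hX hs) n).trans (law_preimage_eval π (hX hs) 0).symm
  filter_upwards [ProbabilityTheory.strong_law_ae_real _ h0 (fun i j hij => hind.indepFun hij) hid]
    with ω hω
  -- The `+ 1` leaves room above the limit; the absolute value makes the constant nonnegative, so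
  -- `n` may be replaced by `n + 1`.
  refine ⟨|∫ ω, -Real.log (ω 0).r ∂(law π)| + 1, ?_⟩
  filter_upwards [hω.eventually_lt_const ((le_abs_self _).trans_lt (lt_add_one _)),
    eventually_gt_atTop 0] with n hn hn0
  rw [div_lt_iff₀ (by exact_mod_cast hn0)] at hn
  refine hn.le.trans (mul_le_mul_of_nonneg_left (by linarith) (by positivity))

end Probability

/-! ### Small dimension functions -/

/-- After taking logarithms this is `Φ x * |log x| ≤ ε * log |log x|`, which is smallness as soon as
`A x ≥ 1 / ε`; `Φ ≥ 0` allows `A x` to be lowered to `1 / ε`. -/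
lemma IsSmall.eventually_rpow_neg_le {Φ : ℝ → ℝ} (hΦ : IsDimensionFunction Φ) (hs : IsSmall Φ)
    {ε : ℝ} (hε : 0 < ε) : ∀ᶠ x in 𝓝[>] (0 : ℝ), x ^ (-Φ x) ≤ (-Real.log x) ^ ε := by
  obtain ⟨A, δ, hδ, hA, hlim⟩ := hs
  have h1 : Ioo (0 : ℝ) (min δ (Real.exp (-1))) ∈ 𝓝[>] (0 : ℝ) :=
    Ioo_mem_nhdsGT (lt_min hδ (Real.exp_pos _))
  filter_upwards [h1, hlim.eventually_ge_atTop (1 / ε)] with x hx hAx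
  obtain ⟨hx0, hx1⟩ := hx
  have hxe : x < Real.exp (-1) := hx1.trans_le (min_le_right _ _)
  have hlog : 1 < -Real.log x := by
    have := Real.log_lt_log hx0 hxe
    rw [Real.log_exp] at this
    linarith
  have hx1' : x < 1 := hxe.trans (by simp)
  have hn := hΦ.nonneg x ⟨hx0, hx1'⟩
  have h := hA x hx0 (hx1.trans_le (min_le_left _ _))
  have habs : |Real.log x| = -Real.log x := abs_of_neg (by linarith)
  simp only [habs] at h
  rw [le_div_iff₀ (by linarith)] at h
  have h2 : 1 / ε * Φ x * -Real.log x ≤ Real.log (-Real.log x) :=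
    (mul_le_mul_of_nonneg_right (mul_le_mul_of_nonneg_right hAx hn) (by linarith)).trans h
  rw [Real.rpow_def_of_pos hx0, Real.rpow_def_of_pos (by linarith : 0 < -Real.log x)]
  refine Real.exp_le_exp.2 ?_
  have h3 : 1 / ε * Φ x * -Real.log x * ε = Real.log x * -Φ x := by field_simp
  nlinarith [mul_le_mul_of_nonneg_right h2 hε.le]

/-- Along scales decaying at most exponentially, `R ^ (-Φ R)` grows slower than any power. -/
lemma IsSmall.eventually_seq_rpow_neg_le {Φ : ℝ → ℝ} (hΦ : IsDimensionFunction Φ)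
    (hs : IsSmall Φ) {R : ℕ → ℝ} (hR : Tendsto R atTop (𝓝[>] 0)) {K : ℝ}
    (hK : ∀ᶠ n : ℕ in atTop, -Real.log (R n) ≤ K * (n + 1)) {ε : ℝ} (hε : 0 < ε) :
    ∀ᶠ n : ℕ in atTop, R n ^ (-Φ (R n)) ≤ ((n : ℝ) + 1) ^ ε := by
  -- Half of the exponent is kept in reserve to absorb the constant `|K|`.
  have hlim : Tendsto (fun n : ℕ => ((n : ℝ) + 1) ^ (ε / 2)) atTop atTop :=
    (tendsto_rpow_atTop (by positivity)).comp
      (tendsto_natCast_atTop_atTop.atTop_add tendsto_const_nhds)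
  have hlog : ∀ᶠ n : ℕ in atTop, 0 ≤ -Real.log (R n) :=
    (Real.tendsto_log_nhdsGT_zero.comp hR).eventually (eventually_le_atBot 0) |>.mono
      fun n hn => by simpa using hn
  filter_upwards [hR.eventually (hs.eventually_rpow_neg_le hΦ (half_pos hε)), hK, hlog,
    hlim.eventually_ge_atTop (|K| ^ (ε / 2))] with n h1 h2 h3 h4
  have hn : (0 : ℝ) < (n : ℝ) + 1 := by positivity
  calc R n ^ (-Φ (R n)) ≤ (-Real.log (R n)) ^ (ε / 2) := h1
    _ ≤ (|K| * ((n : ℝ) + 1)) ^ (ε / 2) := Real.rpow_le_rpow h3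
        (h2.trans (mul_le_mul_of_nonneg_right (le_abs_self K) hn.le)) (by positivity)
    _ = |K| ^ (ε / 2) * ((n : ℝ) + 1) ^ (ε / 2) := Real.mul_rpow (abs_nonneg K) hn.le
    _ ≤ ((n : ℝ) + 1) ^ (ε / 2) * ((n : ℝ) + 1) ^ (ε / 2) := by gcongr
    _ = ((n : ℝ) + 1) ^ ε := by rw [← Real.rpow_add hn, add_halves]

/-! ### Geometry of the Moran sets -/

section Geometry

variable {ρ : ℕ → ℝ} {τ : ℝ} {ω : Samples ρ} (C : MoranSets τ ω)

/-- The length of the Moran sets of step `n`. -/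
def stepLength (ω : Samples ρ) (n : ℕ) : ℝ := ∏ k ∈ Finset.range n, (ω k).r

lemma stepLength_succ (ω : Samples ρ) (n : ℕ) :
    stepLength ω (n + 1) = stepLength ω n * (ω n).r := Finset.prod_range_succ _ _

lemma stepLength_pos (ω : Samples ρ) (n : ℕ) : 0 < stepLength ω n :=
  Finset.prod_pos fun k _ => (ω k).r_pos

lemma log_stepLength (ω : Samples ρ) (n : ℕ) :
    -Real.log (stepLength ω n) = ∑ k ∈ Finset.range n, -Real.log (ω k).r := by
  rw [stepLength, Real.log_prod fun k _ => (ω k).r_pos.ne', Finset.sum_neg_distrib]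

lemma tendsto_stepLength (hr : ∀ s : Step ρ, s.r ≤ 1 / 2) (ω : Samples ρ) :
    Tendsto (stepLength ω) atTop (𝓝 0) := by
  refine squeeze_zero (fun n => (stepLength_pos ω n).le) (fun n => ?_)
    (tendsto_pow_atTop_nhds_zero_of_lt_one (by norm_num) (by norm_num : (1 / 2 : ℝ) < 1))
  exact (Finset.prod_le_prod (fun k _ => (ω k).r_pos.le) fun k _ => hr (ω k)).trans_eq (by simp)

lemma tendsto_const_mul_stepLength (hr : ∀ s : Step ρ, s.r ≤ 1 / 2) (ω : Samples ρ) {a : ℝ}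
    (ha : 0 < a) : Tendsto (fun n => a * stepLength ω n) atTop (𝓝[>] 0) :=
  tendsto_nhdsWithin_iff.2 ⟨by simpa using (tendsto_stepLength hr ω).const_mul a,
    Eventually.of_forall fun n => mul_pos ha (stepLength_pos ω n)⟩

lemma eventually_neg_log_const_mul_stepLength_le {a : ℝ} (ha : 0 < a) {K : ℝ}
    (hK : ∀ᶠ n : ℕ in atTop, ∑ k ∈ Finset.range n, -Real.log (ω k).r ≤ K * (n + 1)) :
    ∀ᶠ n : ℕ in atTop, -Real.log (a * stepLength ω n) ≤ (K + |Real.log a|) * (n + 1) := by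
  filter_upwards [hK] with n hn
  rw [Real.log_mul ha.ne' (stepLength_pos ω n).ne', neg_add, log_stepLength]
  have h1 := neg_abs_le (Real.log a)
  have h2 : 0 ≤ |Real.log a| * n := by positivity
  linarith

namespace MoranSets

lemma dist_le_stepLength (n : ℕ) (w : Word ω n) {x y : ℝ} (hx : x ∈ C.I n w) (hy : y ∈ C.I n w) :
    dist x y ≤ stepLength ω n := by
  induction n generalizing x y with
  | zero =>
    rw [C.I_zero] at hx hy
    simpa [stepLength] using Real.dist_le_of_mem_Icc hx hy
  | succ n ih =>
    obtain ⟨-, S, hS, h⟩ := C.similar n w.1 w.2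
    have h' : C.I (n + 1) w = S '' C.I n w.1 := h
    rw [h'] at hx hy
    obtain ⟨x, hx, rfl⟩ := hx
    obtain ⟨y, hy, rfl⟩ := hy
    rw [hS, stepLength_succ, mul_comm]
    exact mul_le_mul_of_nonneg_right (ih w.1 hx hy) (ω n).r_pos.le

lemma measure_pos (hτ : 0 < τ) (n : ℕ) (w : Word ω n) : 0 < moranMeasure C (C.I n w) := by
  induction n with
  | zero => rw [moranMeasure_root C hτ]; exact one_pos
  | succ n ih =>
    have h := moranMeasure_child C hτ n w.1 w.2
    exact (ENNReal.mul_pos (ih w.1).ne' (ENNReal.ofReal_pos.2 ((ω n).p_pos w.2)).ne').trans_eq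
      h.symm

/-- A set of positive probability is nonempty. -/
lemma exists_path (C : MoranSets τ ω) (hτ : 0 < τ) (n : ℕ) (w : Word ω n) : ∃ x : Path ω, x.word n = w := by
  have h := C.measure_pos hτ n w
  rw [moranMeasure_apply C hτ] at h
  exact nonempty_of_measure_ne_zero h.ne'

lemma point_mem_support (hτ : 0 < τ) (hr : ∀ s : Step ρ, s.r ≤ 1 / 2) (x : Path ω) :
    C.point x ∈ (moranMeasure C).support := by
  rw [Measure.mem_support_iff_forall]
  intro U hU
  obtain ⟨ε, hε, hU⟩ := Metric.mem_nhds_iff.1 hU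
  obtain ⟨n, hn⟩ := ((tendsto_stepLength hr ω).eventually_lt_const hε).exists
  exact (C.measure_pos hτ n (x.word n)).trans_le (measure_mono fun y hy =>
    hU ((C.dist_le_stepLength n _ hy (C.point_mem x n)).trans_lt hn))

lemma exists_mem_support (hτ : 0 < τ) (hr : ∀ s : Step ρ, s.r ≤ 1 / 2) (n : ℕ) (w : Word ω n) :
    ∃ x ∈ (moranMeasure C).support, x ∈ C.I n w := by
  obtain ⟨x, hx⟩ := C.exists_path hτ n w
  exact ⟨C.point x, C.point_mem_support hτ hr x, hx ▸ C.point_mem x n⟩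

/-- The measure is carried by the points of paths, and a path avoiding `w` ends in another Moran set
of step `n`, at distance at least `δ`. The ball is open, so `r = δ` is allowed. -/
lemma measure_ball_le (n : ℕ) (w : Word ω n) {δ : ℝ}
    (hw : ∀ v, v ≠ w → IsApart δ (C.I n w) (C.I n v)) {x r : ℝ} (hx : x ∈ C.I n w) (hr : r ≤ δ) :
    (moranMeasure C).real (Metric.ball x r) ≤ (moranMeasure C).real (C.I n w) := by
  refine ENNReal.toReal_mono (measure_ne_top _ _) ?_
  rw [moranMeasure, Measure.map_apply C.measurable_point measurableSet_ball,
    Measure.map_apply C.measurable_point (C.isCompact n w).measurableSet]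
  refine measure_mono fun y hy => ?_
  have hmem := C.point_mem y n
  by_cases h : y.word n = w
  · exact h ▸ hmem
  · have h1 := hw _ h x hx _ hmem
    rw [mem_preimage, Metric.mem_ball, dist_comm] at hy
    linarith

lemma le_measure_ball (n : ℕ) (w : Word ω n) {x r : ℝ} (hx : x ∈ C.I n w)
    (hr : stepLength ω n < r) :
    (moranMeasure C).real (C.I n w) ≤ (moranMeasure C).real (Metric.ball x r) :=
  measureReal_mono fun _ hy => (C.dist_le_stepLength n w hy hx).trans_lt hr

lemma measureReal_pos (hτ : 0 < τ) (n : ℕ) (w : Word ω n) :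
    0 < (moranMeasure C).real (C.I n w) :=
  ENNReal.toReal_pos (C.measure_pos hτ n w).ne' (measure_ne_top _ _)

lemma measureReal_child (hτ : 0 < τ) (n : ℕ) (w : Word ω n) (j : Fin (ω n).T) :
    (moranMeasure C).real (C.I (n + 1) (w.child j)) =
      (moranMeasure C).real (C.I n w) * (ω n).p j := by
  rw [Measure.real, moranMeasure_child C hτ, ENNReal.toReal_mul,
    ENNReal.toReal_ofReal ((ω n).p_pos j).le, Measure.real]

end MoranSets

lemma Step.exists_p_eq_m (s : Step ρ) : ∃ j, s.p j = s.m :=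
  have : Nonempty (Fin s.T) := ⟨⟨0, by have := s.two_le_T; omega⟩⟩
  exists_eq_ciInf_of_finite

lemma Step.exists_p_eq_M (s : Step ρ) : ∃ j, s.p j = s.M :=
  have : Nonempty (Fin s.T) := ⟨⟨0, by have := s.two_le_T; omega⟩⟩
  exists_eq_ciSup_of_finite

lemma Word.nonempty (ω : Samples ρ) (n : ℕ) : Nonempty (Word ω n) := by
  have x : Path ω := fun n => ⟨0, by have := (ω n).two_le_T; omega⟩
  exact ⟨x.word n⟩

end Geometry

/-! ### The dimensions of a single Moran measure -/

section Dimension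

variable {ρ : ℕ → ℝ} {τ : ℝ} {ω : Samples ρ} (C : MoranSets τ ω) {Φ : ℝ → ℝ}

lemma rpow_one_add_eq {R a : ℝ} (hR : 0 < R) : R ^ (1 + a) * R ^ (-a) = R := by
  rw [← Real.rpow_add hR, add_neg_cancel_right, Real.rpow_one]

lemma tendsto_add_one_rpow {a : ℝ} (ha : 0 < a) :
    Tendsto (fun n : ℕ => ((n : ℝ) + 1) ^ a) atTop atTop :=
  (tendsto_rpow_atTop ha).comp (tendsto_natCast_atTop_atTop.atTop_add tendsto_const_nhds)

/-- If the minimal probabilities are infinitely often polynomially small, then no exponent is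
admitted for the upper dimension. -/
lemma upperExponents_eq_empty (hτ0 : 0 < τ) (hτ1 : τ < 1) (hr : ∀ s : Step ρ, s.r ≤ 1 / 2)
    (hΦ : IsDimensionFunction Φ) (hs : IsSmall Φ) (hC : C.StrongMin) {K : ℝ}
    (hK : ∀ᶠ n : ℕ in atTop, ∑ k ∈ Finset.range n, -Real.log (ω k).r ≤ K * (n + 1)) {θ : ℝ}
    (hθ : 0 < θ) (hm : ∃ᶠ n : ℕ in atTop, (ω n).m ≤ ((n : ℝ) + 1) ^ (-(1 / θ))) :
    upperExponents Φ (moranMeasure C) = ∅ := by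
  refine eq_empty_of_forall_notMem ?_
  rintro d₀ ⟨C₁, C₂, hC₁, hC₁', hC₂, H⟩
  -- Since `R / r ≥ 1` below, raising the exponent only weakens the upper bound.
  obtain ⟨d, hd, hdd⟩ : ∃ d : ℝ, 0 < d ∧ d₀ ≤ d := ⟨max d₀ 1, by positivity, le_max_left _ _⟩
  -- With this `ε`, the factor `((n + 1) ^ ε) ^ d` is `(n + 1) ^ (1 / (2 * θ))`, the square root of
  -- the gain `(n + 1) ^ (1 / θ)` in measure.
  have hε : 0 < 1 / (2 * θ * d) := by positivity
  have hR := tendsto_const_mul_stepLength hr ω (a := 2) two_pos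
  have hgrow := hs.eventually_seq_rpow_neg_le hΦ hR
    (eventually_neg_log_const_mul_stepLength_le two_pos hK) hε
  obtain ⟨n, hmn, hg, hRC, hlarge⟩ := (hm.and_eventually (hgrow.and ((hR.eventually
    (Ioo_mem_nhdsGT hC₁)).and ((tendsto_add_one_rpow (by positivity :
      0 < 1 / (2 * θ))).eventually_gt_atTop (C₂ * (4 / τ) ^ d))))).exists
  obtain ⟨w⟩ := Word.nonempty ω n
  obtain ⟨j, hj⟩ := (ω n).exists_p_eq_m
  obtain ⟨x, hxs, hx⟩ := C.exists_mem_support hτ0 hr (n + 1) (w.child j)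
  have hxw : x ∈ C.I n w := (C.similar n w j).1 hx
  have hL := stepLength_pos ω n
  set L := stepLength ω n with hLdef
  set R := 2 * L with hRdef
  have hR0 : 0 < R := hRC.1
  have hR1 : R < 1 := hRC.2.trans hC₁'
  have hΦR := hΦ.nonneg R ⟨hR0, hR1⟩
  have hpow : 0 < R ^ (1 + Φ R) := Real.rpow_pos_of_pos hR0 _
  have hpowle : R ^ (1 + Φ R) ≤ R := by
    simpa using Real.rpow_le_rpow_of_exponent_ge hR0 hR1.le (by linarith : 1 ≤ 1 + Φ R)
  have hneg : 1 ≤ R ^ (-Φ R) :=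
    Real.one_le_rpow_of_pos_of_le_one_of_nonpos hR0 hR1.le (by linarith)
  -- The factor `τ / 4` puts `r` strictly below `R ^ (1 + Φ R)` and, as `R = 2L`, gives `r ≤ τL/2`,
  -- within the gap `τL`.
  set r := τ / 4 * R ^ (1 + Φ R) with hrdef
  have hr0 : 0 < r := by positivity
  have hratio : R / r = 4 / τ * R ^ (-Φ R) := by
    rw [hrdef, div_eq_iff (by positivity)]
    calc R = R ^ (1 + Φ R) * R ^ (-Φ R) := (rpow_one_add_eq hR0).symm
      _ = _ := by field_simp
  have key := H r R hr0 (by nlinarith) hpowle hR0 hRC.2.le x hxs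
  have hup : (moranMeasure C).real (C.I n w) ≤ (moranMeasure C).real (Metric.ball x R) :=
    C.le_measure_ball n w hxw (by rw [← hLdef]; linarith)
  have hlow : (moranMeasure C).real (Metric.ball x r) ≤
      (moranMeasure C).real (C.I n w) * (ω n).m := by
    rw [← hj, ← C.measureReal_child hτ0]
    exact C.measure_ball_le (n + 1) (w.child j) (hC n w j hj) hx
      (show r ≤ τ * L by nlinarith)
  have hIpos := C.measureReal_pos hτ0 n w
  have hballpos : 0 < (moranMeasure C).real (Metric.ball x r) :=
    ENNReal.toReal_pos (Measure.mem_support_iff_forall x |>.1 hxs _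
      (Metric.ball_mem_nhds x hr0)).ne' (measure_ne_top _ _)
  have hn : (0 : ℝ) < (n : ℝ) + 1 := by positivity
  have hmpos : 0 < (ω n).m := hj ▸ (ω n).p_pos j
  have h1 : ((n : ℝ) + 1) ^ (1 / θ) ≤
      (moranMeasure C).real (Metric.ball x R) / (moranMeasure C).real (Metric.ball x r) := by
    rw [le_div_iff₀ hballpos]
    calc ((n : ℝ) + 1) ^ (1 / θ) * (moranMeasure C).real (Metric.ball x r)
        ≤ ((n : ℝ) + 1) ^ (1 / θ) *
          ((moranMeasure C).real (C.I n w) * ((n : ℝ) + 1) ^ (-(1 / θ))) := by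
          gcongr
          exact hlow.trans (by gcongr)
      _ = (moranMeasure C).real (C.I n w) := by
          rw [Real.rpow_neg hn.le]
          field_simp
      _ ≤ _ := hup
  have h2 : C₂ * (R / r) ^ d₀ ≤ C₂ * (4 / τ) ^ d * ((n : ℝ) + 1) ^ (1 / (2 * θ)) := by
    have hτ4 : 1 ≤ 4 / τ := by rw [le_div_iff₀ hτ0]; linarith
    have hRr : 1 ≤ R / r := by rw [hratio]; exact one_le_mul_of_one_le_of_one_le hτ4 hneg
    rw [mul_assoc]
    refine mul_le_mul_of_nonneg_left ?_ hC₂.le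
    calc (R / r) ^ d₀ ≤ (R / r) ^ d := Real.rpow_le_rpow_of_exponent_le hRr hdd
      _ = (4 / τ) ^ d * (R ^ (-Φ R)) ^ d := by
          rw [hratio, Real.mul_rpow (by positivity) (by positivity)]
      _ ≤ (4 / τ) ^ d * (((n : ℝ) + 1) ^ (1 / (2 * θ * d))) ^ d := by gcongr
      _ = _ := by
          rw [← Real.rpow_mul hn.le]
          congr 2
          field_simp
  have h3 : ((n : ℝ) + 1) ^ (1 / θ) =
      ((n : ℝ) + 1) ^ (1 / (2 * θ)) * ((n : ℝ) + 1) ^ (1 / (2 * θ)) := by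
    rw [← Real.rpow_add hn]
    congr 1
    field_simp
    norm_num
  have h4 := h1.trans (key.trans h2)
  rw [h3] at h4
  exact absurd (le_of_mul_le_mul_right h4 (by positivity)) (not_le.2 hlarge)

lemma zero_mem_lowerExponents (μ : Measure ℝ) [IsFiniteMeasure μ] : 0 ∈ lowerExponents Φ μ := by
  refine ⟨1 / 2, 1, by norm_num, by norm_num, one_pos, fun r R hr hrR hRR hR _ x hx => ?_⟩
  have hpos : 0 < μ.real (Metric.ball x r) :=
    ENNReal.toReal_pos (Measure.mem_support_iff_forall x |>.1 hx _
      (Metric.ball_mem_nhds x hr)).ne' (measure_ne_top _ _)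
  rw [Real.rpow_zero, mul_one, le_div_iff₀ hpos, one_mul]
  exact measureReal_mono (Metric.ball_subset_ball (hrR.le.trans hRR))

/-- If the ratios are infinitely often polynomially small, then no positive exponent is admitted
for the lower dimension. -/
lemma nonpos_of_mem_lowerExponents (hτ0 : 0 < τ) (hτ1 : τ < 1) (hr : ∀ s : Step ρ, s.r ≤ 1 / 2)
    (hΦ : IsDimensionFunction Φ) (hs : IsSmall Φ) (hC : C.StrongMax) {K : ℝ}
    (hK : ∀ᶠ n : ℕ in atTop, ∑ k ∈ Finset.range n, -Real.log (ω k).r ≤ K * (n + 1)) {θ : ℝ}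
    (hθ : 0 < θ) (hm : ∃ᶠ n : ℕ in atTop, (ω n).r ≤ ((n : ℝ) + 1) ^ (-(1 / θ))) {d : ℝ}
    (hd : d ∈ lowerExponents Φ (moranMeasure C)) : d ≤ 0 := by
  by_contra! hd0
  obtain ⟨C₁, C₂, hC₁, hC₁', hC₂, H⟩ := hd
  have hR := tendsto_const_mul_stepLength hr ω (a := τ / 2) (by positivity)
  have hgrow := hs.eventually_seq_rpow_neg_le hΦ hR
    (eventually_neg_log_const_mul_stepLength_le (by positivity) hK)
    (by positivity : 0 < 1 / (2 * θ))
  -- The bound `4 / τ` will make `R / r` exceed the window width; the bound `1 / C₂` yields the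
  -- final contradiction.
  obtain ⟨n, hrn, hg, hRC, hlarge, hlarge'⟩ := (hm.and_eventually (hgrow.and ((hR.eventually
    (Ioo_mem_nhdsGT hC₁)).and (((tendsto_add_one_rpow (by positivity :
      0 < 1 / (2 * θ))).eventually_gt_atTop (4 / τ)).and ((tendsto_add_one_rpow (by positivity :
      0 < 1 / (2 * θ) * d)).eventually_gt_atTop (1 / C₂)))))).exists
  obtain ⟨w⟩ := Word.nonempty ω n
  obtain ⟨j, hj⟩ := (ω n).exists_p_eq_M
  obtain ⟨x, hxs, hx⟩ := C.exists_mem_support hτ0 hr (n + 1) (w.child j)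
  have hL := stepLength_pos ω n
  have hsucc := stepLength_succ ω n
  set L := stepLength ω n with hLdef
  set R := τ / 2 * L with hRdef
  have hR0 : 0 < R := hRC.1
  have hR1 : R < 1 := hRC.2.trans hC₁'
  have hΦR := hΦ.nonneg R ⟨hR0, hR1⟩
  have hpowle : R ^ (1 + Φ R) ≤ R := by
    simpa using Real.rpow_le_rpow_of_exponent_ge hR0 hR1.le (by linarith : 1 ≤ 1 + Φ R)
  have hq := (ω n).r_pos
  set q := (ω n).r with hqdef
  -- The small radius is twice the length `L * q` of the child, so that the open ball contains the
  -- child.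
  have hr0 : 0 < 2 * (L * q) := by positivity
  have hn : (0 : ℝ) < (n : ℝ) + 1 := by positivity
  set b := ((n : ℝ) + 1) ^ (1 / (2 * θ)) with hb
  have hb0 : 0 < b := Real.rpow_pos_of_pos hn _
  have hqb : q * (b * b) ≤ 1 := by
    have h3 : b * b = ((n : ℝ) + 1) ^ (1 / θ) := by
      rw [hb, ← Real.rpow_add hn]
      congr 1
      field_simp
      norm_num
    rw [Real.rpow_neg hn.le, ← h3] at hrn
    calc q * (b * b) ≤ (b * b)⁻¹ * (b * b) := by gcongr
      _ = 1 := inv_mul_cancel₀ (by positivity)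
  -- Here `R / r = τ / (4q) ≥ τ b² / 4`, and `b > 4 / τ`.
  have hbR : b < R / (2 * (L * q)) := by
    rw [lt_div_iff₀ hr0, hRdef]
    rw [div_lt_iff₀ hτ0] at hlarge
    have h5 : 4 * (b * q) < τ := by
      have : 4 * (b * q) < b * τ * (b * q) := by gcongr
      nlinarith
    nlinarith
  -- Admissibility of the radii: `r < R ^ (1 + Φ R)` is equivalent to `R ^ (-Φ R) < R / r`, and `b`
  -- separates the two sides.
  have hlt : 2 * (L * q) < R ^ (1 + Φ R) := by
    have h6 : R ^ (-Φ R) < R / (2 * (L * q)) := hg.trans_lt hbR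
    rw [lt_div_iff₀ hr0] at h6
    have h7 : 0 < R ^ (-Φ R) := Real.rpow_pos_of_pos hR0 _
    refine lt_of_mul_lt_mul_right ?_ h7.le
    rw [rpow_one_add_eq hR0, mul_comm]
    exact h6
  have key := H _ R hr0 hlt hpowle hR0 hRC.2.le x hxs
  have hup : (moranMeasure C).real (Metric.ball x R) ≤
      (moranMeasure C).real (C.I (n + 1) (w.child j)) :=
    C.measure_ball_le (n + 1) (w.child j) (hC n w j hj) hx
      (show R ≤ τ * L by nlinarith)
  have hlow : (moranMeasure C).real (C.I (n + 1) (w.child j)) ≤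
      (moranMeasure C).real (Metric.ball x (2 * (L * q))) :=
    C.le_measure_ball (n + 1) (w.child j) hx (by rw [hsucc]; nlinarith)
  have h8 : C₂ * (R / (2 * (L * q))) ^ d ≤ 1 :=
    key.trans (div_le_one_of_le₀ (hup.trans hlow) measureReal_nonneg)
  have h9 : b ^ d ≤ (R / (2 * (L * q))) ^ d := by gcongr
  have h10 : 1 / C₂ < b ^ d := by rwa [hb, ← Real.rpow_mul hn.le]
  rw [div_lt_iff₀ hC₂] at h10
  nlinarith

lemma upperDim_eq_top (μ : Measure ℝ) (h : upperExponents Φ μ = ∅) : upperDim Φ μ = ⊤ := by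
  rw [upperDim, h, image_empty, sInf_empty]

lemma lowerDim_eq_zero (μ : Measure ℝ) [IsFiniteMeasure μ]
    (h : ∀ d ∈ lowerExponents Φ μ, d ≤ 0) : lowerDim Φ μ = 0 := by
  refine le_antisymm (sSup_le ?_) (le_sSup ⟨0, zero_mem_lowerExponents μ, rfl⟩)
  rintro _ ⟨d, hd, rfl⟩
  exact EReal.coe_nonpos.2 (h d hd)

end Dimension

end RandomMoran

/-! ### Almost sure values of the dimensions -/

theorem mainTheorem7
    (τ : ℝ) (hτ0 : 0 < τ) (hτ1 : τ < 1)
    (ρ : ℕ → ℝ)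
    (hρ : ∀ t : ℕ, 2 ≤ t → 0 < ρ t ∧ ρ t ≤ 1 / 2 ∧
      ∀ r : ℝ, 0 < r → r ≤ ρ t → RandomMoran.HasSeparation (Icc (0 : ℝ) 1) t r τ)
    (π : Measure (RandomMoran.Step ρ)) [IsProbabilityMeasure π]
    (hbasic : ∃ A : ℝ, 0 < A ∧ ∀ l : ℝ, |l| ≤ A →
      Integrable (fun ω : RandomMoran.Samples ρ => Real.exp (l * -Real.log (ω 0).r))
        (RandomMoran.law π))
    (C : (ω : RandomMoran.Samples ρ) → RandomMoran.MoranSets τ ω)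
    (Φ : ℝ → ℝ) (hΦ : RandomMoran.IsDimensionFunction Φ) (hsmall : RandomMoran.IsSmall Φ) :
    ((∀ᵐ ω ∂(RandomMoran.law π), (C ω).StrongMin) →
      (∃ θ c : ℝ, 0 < θ ∧ 0 < c ∧ ∀ᶠ z : ℝ in 𝓝[>] 0,
        c * z ^ θ ≤ (RandomMoran.law π).real {ω | (ω 0).m ≤ z}) →
      ∀ᵐ ω ∂(RandomMoran.law π),
        RandomMoran.upperDim Φ (RandomMoran.moranMeasure (C ω)) = ⊤) ∧
    ((∀ᵐ ω ∂(RandomMoran.law π), (C ω).StrongMax) →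
      (∃ θ c : ℝ, 0 < θ ∧ 0 < c ∧ ∀ᶠ z : ℝ in 𝓝[>] 0,
        c * z ^ θ ≤ (RandomMoran.law π).real {ω | (ω 0).r ≤ z}) →
      ∀ᵐ ω ∂(RandomMoran.law π),
        RandomMoran.lowerDim Φ (RandomMoran.moranMeasure (C ω)) = 0) := by
  have hr : ∀ s : RandomMoran.Step ρ, s.r ≤ 1 / 2 := fun s =>
    s.2.1.2.2.trans (hρ s.1 s.1.2).2.1
  obtain ⟨A, hA, hint⟩ := hbasic
  have hgrow := RandomMoran.ae_exists_sum_neg_log_le π (fun s => (hr s).trans (by norm_num)) hA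
    (hint A (abs_of_pos hA).le)
  constructor
  · rintro hgap ⟨θ, c, hθ, hc, htail⟩
    filter_upwards [hgap, hgrow, RandomMoran.ae_frequently_le_rpow π
      RandomMoran.Step.measurable_m hθ hc htail] with ω h1 ⟨K, hK⟩ h3
    exact RandomMoran.upperDim_eq_top _
      (RandomMoran.upperExponents_eq_empty (C ω) hτ0 hτ1 hr hΦ hsmall h1 hK hθ h3)
  · rintro hgap ⟨θ, c, hθ, hc, htail⟩
    filter_upwards [hgap, hgrow, RandomMoran.ae_frequently_le_rpow π
      RandomMoran.Step.measurable_r hθ hc htail] with ω h1 ⟨K, hK⟩ h3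
    exact RandomMoran.lowerDim_eq_zero _ fun d hd =>
      RandomMoran.nonpos_of_mem_lowerExponents (C ω) hτ0 hτ1 hr hΦ hsmall h1 hK hθ h3 hd
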